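/- A graph $D$ is a (unit) distance graph in $\mathbb{R}^d$ if $V(D)\subseteq\mathbb{R}^d$ and every edge of $D$ joins two points at Euclidean distance $1$ (not all pairs at distance $1$ need be edges). The distance Ramsey number $R_D(s,t,d)$ is the minimum number $n$ such that for every simple graph $G$ on $n$ vertices, either $G$ contains an induced $s$-vertex subgraph isomorphic to a distance graph in $\mathbb{R}^d$, or the complement $\bar G$ contains an induced $t$-vertex subgraph isomorphic to a distance graph in $\mathbb{R}^d$. Let $d\in\{4,5\}$. Then there is a function $f:\mathbb{N}\to\mathbb{R}$ with $f(s)\to 0$ as $s\to\infty$ such that for every integer $s\ge 1$ $$R_D(s,s,d)\;\ge\;\left(\frac{64}{41}\right)^{\frac{s}{12}\,(1+f(s))}.$$ Moreover $\left|\tfrac{1}{12}\log_2\tfrac{64}{41}-0.053537\right|<10^{-6}$, so that the right-hand side is approximately $2^{0.053537\,s}$. -/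

import Mathlib

open Filter Topology

/-- A simple graph whose vertex set `V` is a set of points of `ℝ^d` is a (unit) distance graph
if every edge joins two points at Euclidean distance `1`. (Not every pair of vertices at
distance `1` has to be an edge.) -/
def IsDistanceGraph {d : ℕ} {V : Set (EuclideanSpace ℝ (Fin d))} (D : SimpleGraph V) : Prop :=
  ∀ x y : V, D.Adj x y →
    dist (x : EuclideanSpace ℝ (Fin d)) (y : EuclideanSpace ℝ (Fin d)) = 1

/-- `H` is isomorphic to a distance graph in `ℝ^d`. -/
def IsIsoToDistanceGraph (d : ℕ) {W : Type*} (H : SimpleGraph W) : Prop :=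
  ∃ (V : Set (EuclideanSpace ℝ (Fin d))) (D : SimpleGraph V),
    IsDistanceGraph D ∧ Nonempty (H ≃g D)

/-- `G` contains an induced `s`-vertex subgraph isomorphic to a distance graph in `ℝ^d`. -/
def ContainsInducedDistanceGraph (s d : ℕ) {W : Type*} (G : SimpleGraph W) : Prop :=
  ∃ S : Finset W, S.card = s ∧ IsIsoToDistanceGraph d (G.induce (S : Set W))

/-- The distance Ramsey number `R_D(s, t, d)`: the minimum `n` such that for every graph `G` on
`n` vertices, `G` contains an induced `s`-vertex subgraph isomorphic to a distance graph in `ℝ^d`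
or the complement of `G` contains an induced `t`-vertex subgraph isomorphic to a distance graph
in `ℝ^d`. -/
noncomputable def distanceRamsey (s t d : ℕ) : ℕ :=
  sInf {n : ℕ | ∀ G : SimpleGraph (Fin n),
    ContainsInducedDistanceGraph s d G ∨ ContainsInducedDistanceGraph t d Gᶜ}

/-!
The lower bound is a first moment argument. A distance graph in `ℝ^d` with `d ≤ 5` does not contain
`K_{3,3,3}`: if three triples of distinct points are pairwise at distance `1`, each triple lies on a
sphere, so it is not collinear and spans a plane, and the three planes are pairwise orthogonal, which
needs six dimensions (`six_le_finrank_of_dist_eq_one`). So if `n = R_D(s, s, d)`, then every graph on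
`n` vertices has an `s`-set on which the graph or its complement is without `K_{3,3,3}`. Counting all
graphs on `n` vertices gives `2 ^ (s choose 2) ≤ 2 n ^ s f(s)`, where `f(s)` is the number of
labelled graphs on `s` vertices without `K_{3,3,3}` (`two_pow_choose_le`). This uses that the
infimum defining `R_D` is attained, which is the finite Ramsey theorem.

It remains to see that `f(s) ≤ K 2 ^ (13 s² / 32)`, for then `n ≥ 2 ^ ((3/32 - o(1)) s)`, and `3/32`
exceeds `1/18 > (1/12) log₂ (64/41)`. In particular the required bound holds without any correction
for all large `s`. The bound on `f` comes from removing boundedly many vertices at a time: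

* If a graph has no `K_{16,16}`, then by pigeonhole all but boundedly many vertices have fewer than
  `16` neighbours in a fixed set of `64` vertices, so have fewer than `2 ^ 48` possible
  neighbourhoods in it. Thus `h(64 + m) ≤ C 2 ^ (48 m) h(m)` for the number `h` of such graphs.
* If a graph has no `K_{3,3,3}` but has a copy of `K_{16,16}`, then all but boundedly many vertices
  have at most two neighbours in one of the sides of this copy, so have fewer than `2 ^ 25` possible
  neighbourhoods in it. Thus `f(32 + m) ≤ h(32 + m) + (32 + m) ^ 32 C 2 ^ (25 m) f(m)`.

Both recursions are instances of `SimpleGraph.exists_card_le_mul_pow` and are solved by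
`exists_le_mul_two_rpow_sq`.
-/

/-! ### Three mutually equidistant triples span six dimensions -/

theorem six_le_finrank_of_dist_eq_one {E : Type*} [NormedAddCommGroup E] [InnerProductSpace ℝ E]
    [FiniteDimensional ℝ E] (p : Fin 3 → Fin 3 → E) (hinj : ∀ i, Function.Injective (p i))
    (hdist : ∀ i j, i ≠ j → ∀ k l, dist (p i k) (p j l) = 1) :
    6 ≤ Module.finrank ℝ E := by
  -- The direction spaces of the three triples are planes and pairwise orthogonal.
  let V : Fin 3 → Submodule ℝ E := fun i => vectorSpan ℝ (Set.range (p i))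
  have hdim : ∀ i, Module.finrank ℝ (V i) = 2 := by
    intro i
    obtain ⟨j, hj⟩ : ∃ j : Fin 3, i ≠ j := ⟨i + 1, by fin_cases i <;> decide⟩
    have hcos : EuclideanGeometry.Cospherical (Set.range (p i)) := by
      refine ⟨p j 0, 1, ?_⟩
      rintro _ ⟨k, rfl⟩
      exact hdist i j hj k 0
    exact (hcos.affineIndependent subset_rfl (hinj i)).finrank_vectorSpan rfl
  have horth : ∀ i j, i ≠ j → V i ⟂ V j := by
    intro i j hij
    refine Submodule.isOrtho_span.2 ?_
    rintro _ ⟨_, ⟨k, rfl⟩, _, ⟨k', rfl⟩, rfl⟩ _ ⟨_, ⟨l, rfl⟩, _, ⟨l', rfl⟩, rfl⟩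
    exact EuclideanGeometry.inner_vsub_vsub_of_dist_eq_of_dist_eq
      (by rw [hdist j i hij.symm, hdist j i hij.symm])
      (by rw [hdist j i hij.symm, hdist j i hij.symm])
  have h01 := Submodule.finrank_sup_add_finrank_inf_eq (V 0) (V 1)
  rw [(horth 0 1 (by decide)).disjoint.eq_bot, finrank_bot, hdim, hdim] at h01
  have h012 := Submodule.finrank_add_finrank_le_of_disjoint
    ((Submodule.isOrtho_sup_left.2 ⟨horth 0 2 (by decide), horth 1 2 (by decide)⟩).disjoint)
  rw [hdim] at h012
  omega

/-- The complete tripartite graph with three vertices in each part. -/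
abbrev tripartite : SimpleGraph (Σ _ : Fin 3, Fin 3) :=
  SimpleGraph.completeMultipartiteGraph fun _ : Fin 3 => Fin 3

theorem IsIsoToDistanceGraph.tripartite_free {d : ℕ} (hd : d ≤ 5) {W : Type*} {H : SimpleGraph W}
    (h : IsIsoToDistanceGraph d H) : tripartite.Free H := by
  rintro ⟨c⟩
  obtain ⟨V, D, hD, ⟨e⟩⟩ := h
  have key := six_le_finrank_of_dist_eq_one
    (fun i k => ((e (c ⟨i, k⟩) : V) : EuclideanSpace ℝ (Fin d)))
    (fun i k l hkl => by
      simpa using c.injective (e.injective (Subtype.ext hkl)))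
    (fun i j hij k l => hD _ _ (e.map_rel_iff.2 (c.toHom.map_adj (by simpa using hij))))
  rw [finrank_euclideanSpace_fin] at key
  omega

/-! ### Finiteness of the distance Ramsey number -/

/-- The finite Ramsey theorem for cliques and independent sets inside a vertex set `U`. -/
theorem exists_ramsey_bound (a b : ℕ) : ∃ n : ℕ, ∀ (V : Type) (G : SimpleGraph V) (U : Finset V),
    n ≤ U.card → (∃ S ⊆ U, S.card = a ∧ G.IsClique S) ∨ ∃ S ⊆ U, S.card = b ∧ G.IsIndepSet S := by
  classical
  induction a generalizing b with
  | zero => exact ⟨0, fun V G U _ => Or.inl ⟨∅, by simp⟩⟩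
  | succ a iha =>
    induction b with
    | zero => exact ⟨0, fun V G U _ => Or.inr ⟨∅, by simp⟩⟩
    | succ b ihb =>
      obtain ⟨m, hm⟩ := iha (b + 1)
      obtain ⟨n, hn⟩ := ihb
      refine ⟨m + n + 1, fun V G U hU => ?_⟩
      obtain ⟨v, hv⟩ : U.Nonempty := Finset.card_pos.1 (by omega)
      have hsplit := Finset.card_filter_add_card_filter_not (s := U.erase v) (fun w => G.Adj v w)
      rw [Finset.card_erase_of_mem hv] at hsplit
      have hsub : ∀ (q : V → Prop) [DecidablePred q], (U.erase v).filter q ⊆ U := fun q _ =>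
        (Finset.filter_subset _ _).trans (Finset.erase_subset _ _)
      rcases le_or_gt m ((U.erase v).filter fun w => G.Adj v w).card with h | h
      · rcases hm V G _ h with ⟨S, hS, hcard, hcl⟩ | ⟨S, hS, hcard, hind⟩
        · refine Or.inl ⟨insert v S, Finset.insert_subset hv (hS.trans (hsub _)), ?_, ?_⟩
          · rw [Finset.card_insert_of_notMem fun hvS => by simpa using hS hvS, hcard]
          · rw [Finset.coe_insert, SimpleGraph.isClique_insert]
            exact ⟨hcl, fun w hw _ => (Finset.mem_filter.1 (hS hw)).2⟩
        · exact Or.inr ⟨S, hS.trans (hsub _), hcard, hind⟩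
      · rcases hn V G ((U.erase v).filter fun w => ¬ G.Adj v w) (by omega) with
          ⟨S, hS, hcard, hcl⟩ | ⟨S, hS, hcard, hind⟩
        · exact Or.inl ⟨S, hS.trans (hsub _), hcard, hcl⟩
        · refine Or.inr ⟨insert v S, Finset.insert_subset hv (hS.trans (hsub _)), ?_, ?_⟩
          · rw [Finset.card_insert_of_notMem fun hvS => by simpa using hS hvS, hcard]
          · rw [Finset.coe_insert]
            refine hind.insert fun w hw _ => ?_
            have := (Finset.mem_filter.1 (hS hw)).2
            exact ⟨this, fun h => this h.symm⟩

theorem isIsoToDistanceGraph_of_isIndepSet {d : ℕ} (hd : 1 ≤ d) {W : Type*} {G : SimpleGraph W}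
    {S : Finset W} (hS : G.IsIndepSet S) : IsIsoToDistanceGraph d (G.induce (S : Set W)) := by
  have : NeZero d := ⟨by omega⟩
  have : Infinite (EuclideanSpace ℝ (Fin d)) := Module.Free.infinite ℝ _
  obtain ⟨φ⟩ : Nonempty ((S : Set W) ↪ EuclideanSpace ℝ (Fin d)) :=
    ⟨(Finite.equivFin _).toEmbedding.trans
      (Fin.valEmbedding.trans (Infinite.natEmbedding _))⟩
  refine ⟨Set.range φ, ⊥, fun _ _ h => h.elim, ⟨Equiv.ofInjective φ φ.injective, ?_⟩⟩
  intro x y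
  simp only [SimpleGraph.bot_adj, SimpleGraph.comap_adj, false_iff]
  exact fun h => hS x.2 y.2 h.ne h

/-- The set defining the distance Ramsey number is nonempty, by the finite Ramsey theorem and
because edgeless graphs are distance graphs. Hence its infimum is attained. -/
theorem distanceRamsey_spec {d : ℕ} (hd : 1 ≤ d) (s t : ℕ)
    (G : SimpleGraph (Fin (distanceRamsey s t d))) :
    ContainsInducedDistanceGraph s d G ∨ ContainsInducedDistanceGraph t d Gᶜ := by
  have hne : {n : ℕ | ∀ G : SimpleGraph (Fin n),
      ContainsInducedDistanceGraph s d G ∨ ContainsInducedDistanceGraph t d Gᶜ}.Nonempty := by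
    obtain ⟨n, hn⟩ := exists_ramsey_bound t s
    refine ⟨n, fun G => ?_⟩
    rcases hn _ G Finset.univ (by simp) with ⟨S, -, hcard, hcl⟩ | ⟨S, -, hcard, hind⟩
    · exact Or.inr ⟨S, hcard, isIsoToDistanceGraph_of_isIndepSet hd (by simpa using hcl)⟩
    · exact Or.inl ⟨S, hcard, isIsoToDistanceGraph_of_isIndepSet hd hind⟩
  exact Nat.sInf_mem hne G

theorem distanceRamsey_pos {d s : ℕ} (hd : 1 ≤ d) (hs : 1 ≤ s) : 1 ≤ distanceRamsey s s d := by
  have key : ∀ G : SimpleGraph (Fin (distanceRamsey s s d)),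
      ContainsInducedDistanceGraph s d G → s ≤ distanceRamsey s s d := by
    rintro G ⟨S, hS, -⟩
    simpa [hS] using S.card_le_univ
  rcases distanceRamsey_spec hd s s ⊥ with h | h <;> exact hs.trans (key _ h)

/-! ### Counting functions and graphs across a split vertex set -/

/-- Counting functions that hit a set `B` of values at most `M` times: every such function gets
weight at least `K⁻ᴹ` when each value in `B` is penalised by the factor `1 / K`. -/
theorem card_filter_card_fiber_le {X β : Type*} [Fintype X] [Fintype β] [DecidableEq X]
    [DecidableEq β] (B : Finset X) (M K g : ℕ) (hK : Fintype.card X ≤ K) (hK0 : 0 < K)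
    (hg : Bᶜ.card + 1 ≤ g) :
    (Finset.univ.filter fun r : β → X => (Finset.univ.filter fun w => r w ∈ B).card ≤ M).card
      ≤ K ^ M * g ^ Fintype.card β := by
  let wt : X → ℝ := fun x => if x ∈ B then (K : ℝ)⁻¹ else 1
  have hKpos : (0 : ℝ) < K := by exact_mod_cast hK0
  have hwt0 : ∀ x, 0 ≤ wt x := fun x => by
    simp only [wt]; split_ifs <;> positivity
  have hsum : ∑ x, wt x ≤ g := by
    have h1 : ∑ x, wt x = B.card * (K : ℝ)⁻¹ + Bᶜ.card := by
      rw [← Finset.sum_add_sum_compl B]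
      congr 1
      · rw [Finset.sum_congr rfl fun x hx => if_pos hx]
        simp
      · rw [Finset.sum_congr rfl fun x hx => if_neg (Finset.mem_compl.1 hx)]
        simp
    have h2 : B.card * (K : ℝ)⁻¹ ≤ 1 := by
      rw [← div_eq_mul_inv, div_le_one hKpos]
      exact_mod_cast (Finset.card_le_univ B).trans hK
    have h3 : (Bᶜ.card : ℝ) + 1 ≤ g := by exact_mod_cast hg
    linarith
  have hprod : ∀ r : β → X, (Finset.univ.filter fun w => r w ∈ B).card ≤ M →
      ((K : ℝ)⁻¹) ^ M ≤ ∏ w, wt (r w) := by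
    intro r hr
    rw [Finset.prod_ite]
    simp only [Finset.prod_const, one_pow, mul_one]
    exact pow_le_pow_of_le_one (by positivity) (inv_le_one_of_one_le₀ (by exact_mod_cast hK0)) hr
  have hmain : ((Finset.univ.filter fun r : β → X =>
      (Finset.univ.filter fun w => r w ∈ B).card ≤ M).card : ℝ) * ((K : ℝ)⁻¹) ^ M
        ≤ (g : ℝ) ^ Fintype.card β := by
    calc _ = ∑ r ∈ Finset.univ.filter fun r : β → X =>
            (Finset.univ.filter fun w => r w ∈ B).card ≤ M, ((K : ℝ)⁻¹) ^ M := by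
          rw [Finset.sum_const, nsmul_eq_mul]
      _ ≤ ∑ r ∈ Finset.univ.filter fun r : β → X =>
            (Finset.univ.filter fun w => r w ∈ B).card ≤ M, ∏ w, wt (r w) :=
          Finset.sum_le_sum fun r hr => hprod r (Finset.mem_filter.1 hr).2
      _ ≤ ∑ r : β → X, ∏ w, wt (r w) :=
          Finset.sum_le_sum_of_subset_of_nonneg (Finset.filter_subset _ _)
            fun r _ _ => Finset.prod_nonneg fun w _ => hwt0 _
      _ = (∑ x, wt x) ^ Fintype.card β := by
          rw [← Finset.card_univ, ← Finset.prod_const, Finset.prod_univ_sum]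
          simp
      _ ≤ _ := pow_le_pow_left₀ (Finset.sum_nonneg fun x _ => hwt0 x) hsum _
  rw [inv_pow, ← div_eq_mul_inv, div_le_iff₀ (by positivity)] at hmain
  rw [mul_comm]
  exact_mod_cast hmain

namespace SimpleGraph

variable {α β V W : Type*}

/-- The vertices of `α` adjacent to a given vertex `w` of `β`, in a graph on `α ⊕ β`. -/
def crossNeighbors (G : SimpleGraph (α ⊕ β)) (w : β) : Set α :=
  {a | G.Adj (Sum.inl a) (Sum.inr w)}

/-- A graph on `α ⊕ β` amounts to a graph on `α`, a graph on `β`, and the edges between. -/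
def sumSplit (α β : Type*) : SimpleGraph (α ⊕ β) ≃
    SimpleGraph α × (β → Set α) × SimpleGraph β where
  toFun G := (G.comap Sum.inl, G.crossNeighbors, G.comap Sum.inr)
  invFun x :=
    { Adj := fun u v => match u, v with
        | .inl a, .inl b => x.1.Adj a b
        | .inl a, .inr w => a ∈ x.2.1 w
        | .inr w, .inl a => a ∈ x.2.1 w
        | .inr v, .inr w => x.2.2.Adj v w
      symm := ⟨by
        rintro (a | v) (b | w) h
        · exact SimpleGraph.Adj.symm h
        · exact h
        · exact h
        · exact SimpleGraph.Adj.symm h⟩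
      loopless := ⟨by
        rintro (a | v) h
        · exact SimpleGraph.irrefl _ h
        · exact SimpleGraph.irrefl _ h⟩ }
  left_inv G := by
    ext (a | v) (b | w)
    · rfl
    · rfl
    · exact G.adj_comm _ _
    · rfl
  right_inv x := rfl

/-- Relabelling the vertices of all graphs along a bijection. -/
def comapEquiv (e : V ≃ W) : SimpleGraph W ≃ SimpleGraph V where
  toFun G := G.comap e
  invFun G := G.comap e.symm
  left_inv G := by ext; simp
  right_inv G := by ext; simp

theorem card_comap_inl_mem_mul [Finite α] [Finite β] (F : Set (SimpleGraph α)) :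
    {G : SimpleGraph (α ⊕ β) | G.comap Sum.inl ∈ F}.ncard * Nat.card (SimpleGraph α)
      = F.ncard * Nat.card (SimpleGraph (α ⊕ β)) := by
  have h : {G : SimpleGraph (α ⊕ β) | G.comap Sum.inl ∈ F}
      = (sumSplit α β) ⁻¹' (F ×ˢ Set.univ) := by
    ext G
    simp only [Set.mem_ofPred_eq, Set.mem_preimage, Set.mem_prod, Set.mem_univ, and_true]
    rfl
  rw [h, Set.ncard_preimage_of_injective_subset_range (sumSplit α β).injective
    (by simp [(sumSplit α β).surjective.range_eq]), Set.ncard_prod, Set.ncard_univ,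
    Nat.card_congr (sumSplit α β), Nat.card_prod, Nat.card_prod, Nat.card_prod]
  ring

theorem exists_equiv_extending (φ : V ↪ W) :
    ∃ e : V ⊕ ((Set.range φ)ᶜ : Set W) ≃ W, ∀ v, e (Sum.inl v) = φ v := by
  classical
  exact ⟨(Equiv.sumCongr (Equiv.ofInjective φ φ.injective) (Equiv.refl _)).trans
    (Equiv.Set.sumCompl (Set.range φ)), fun v => by simp⟩

/-- Prescribing the subgraph induced on the image of `φ` to lie in `F` selects the same proportion
of all graphs as `F` has among the graphs on the smaller vertex set. -/
theorem card_comap_mem_mul [Finite W] (φ : V ↪ W) (F : Set (SimpleGraph V)) :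
    {G : SimpleGraph W | G.comap φ ∈ F}.ncard * Nat.card (SimpleGraph V)
      = F.ncard * Nat.card (SimpleGraph W) := by
  have : Finite V := Finite.of_injective φ φ.injective
  obtain ⟨e, he⟩ := exists_equiv_extending φ
  have h : {G : SimpleGraph W | G.comap φ ∈ F}
      = (comapEquiv e) ⁻¹' {G | G.comap Sum.inl ∈ F} := by
    ext G
    have : (G.comap e).comap Sum.inl = G.comap φ := by
      ext; simp [he]
    rw [Set.mem_ofPred_eq, ← this]
    rfl
  rw [h, Set.ncard_preimage_of_injective_subset_range (comapEquiv e).injective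
    (by simp [(comapEquiv e).surjective.range_eq]), card_comap_inl_mem_mul,
    Nat.card_congr (comapEquiv e)]

theorem card_eq_two_pow (s : ℕ) : Nat.card (SimpleGraph (Fin s)) = 2 ^ (s.choose 2) := by
  induction s with
  | zero => simp
  | succ s ih =>
    have h1 : Nat.card (SimpleGraph (Fin 1)) = 1 := by simp
    rw [Nat.card_congr (comapEquiv finSumFinEquiv), Nat.card_congr (sumSplit (Fin s) (Fin 1)),
      Nat.card_prod, Nat.card_prod, ih, h1, Nat.choose_succ_succ' s 1]
    simp [Nat.card_eq_fintype_card, pow_add, mul_comm]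

/-- The key counting step. Let `F` be a family of graphs on a vertex set `W` partitioned into a
bounded part `α` and a rest `β`, inducing on `β` only graphs in `F'`. Suppose every set in `B` is
the neighbourhood in `α` of at most `q` vertices of `β`. Then all but boundedly many vertices of `β`
have a neighbourhood in `α` outside `B`, for which there are fewer than `g` choices, and the
exceptions only cost the constant `C`. -/
theorem exists_card_le_mul_pow (α : Type*) [Finite α] (q : ℕ) :
    ∃ C : ℕ, ∀ (β W : Type) [Finite β] (e : α ⊕ β ≃ W) (B : Set (Set α)) (g : ℕ)
      (F : Set (SimpleGraph W)) (F' : Set (SimpleGraph β)), Bᶜ.ncard + 1 ≤ g →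
      (∀ G ∈ F, G.comap (fun w => e (Sum.inr w)) ∈ F') →
      (∀ G ∈ F, ∀ X ∈ B, {w | (G.comap e).crossNeighbors w = X}.ncard ≤ q) →
      F.ncard ≤ C * g ^ Nat.card β * F'.ncard := by
  classical
  have := Fintype.ofFinite α
  refine ⟨Nat.card (SimpleGraph α) *
    Fintype.card (Set α) ^ (q * Fintype.card (Set α)), ?_⟩
  intro β W _ e B g F F' hg hF' hB
  have := Fintype.ofFinite β
  set K := Fintype.card (Set α)
  let R : Set (β → Set α) := {r | (Finset.univ.filter fun w => r w ∈ B.toFinset).card ≤ q * K}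
  have hR : R.ncard ≤ K ^ (q * K) * g ^ Fintype.card β := by
    have := card_filter_card_fiber_le (β := β) B.toFinset (q * K) K g le_rfl Fintype.card_pos
      (by rwa [← Set.toFinset_compl, ← Set.ncard_eq_toFinset_card'])
    rw [Set.ncard_eq_toFinset_card']
    convert this using 2
    ext r; simp [R]
  -- A graph in `F` is determined by its restrictions to `α` and `β` and the edges between.
  let S : Set (SimpleGraph α × (β → Set α) × SimpleGraph β) := Set.univ ×ˢ (R ×ˢ F')
  have hmaps : ∀ G ∈ F, ((comapEquiv e).trans (sumSplit α β)) G ∈ S := by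
    intro G hG
    refine ⟨Set.mem_univ _, ?_, hF' G hG⟩
    show (Finset.univ.filter fun w => (G.comap e).crossNeighbors w ∈ B.toFinset).card ≤ q * K
    refine (Finset.card_le_mul_card_image_of_maps_to (t := B.toFinset)
      (f := (G.comap e).crossNeighbors) (by simp) q ?_).trans
      (Nat.mul_le_mul_left _ (Finset.card_le_univ _))
    intro X hX
    have hX' : X ∈ B := by simpa using hX
    refine le_trans ?_ (hB G hG X hX')
    rw [Set.ncard_eq_toFinset_card']
    exact Finset.card_le_card fun w hw => by simpa using (Finset.mem_filter.1 hw).2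
  calc F.ncard ≤ S.ncard :=
        Set.ncard_le_ncard_of_injOn _ hmaps (Equiv.injective _).injOn
    _ = Nat.card (SimpleGraph α) * (R.ncard * F'.ncard) := by
        rw [Set.ncard_prod, Set.ncard_prod, Set.ncard_univ]
    _ ≤ Nat.card (SimpleGraph α) * ((K ^ (q * K) * g ^ Fintype.card β) * F'.ncard) := by gcongr
    _ = _ := by rw [Nat.card_eq_fintype_card (α := β)]; ring

end SimpleGraph

/-! ### Recursive bounds for the number of graphs without a complete multipartite subgraph -/

theorem exists_embedding_of_le_ncard {V : Type*} {X : Set V} {k : ℕ} (hk : k ≠ 0)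
    (h : k ≤ X.ncard) : ∃ f : Fin k ↪ V, ∀ i, f i ∈ X := by
  have : Finite X := Set.finite_of_ncard_pos (by omega)
  have := Fintype.ofFinite X
  obtain ⟨f⟩ : Nonempty (Fin k ↪ X) := Function.Embedding.nonempty_of_card_le (by
    rwa [Fintype.card_fin, ← Nat.card_eq_fintype_card, Nat.card_coe_set_eq])
  exact ⟨f.trans (Function.Embedding.subtype _), fun i => (f i).2⟩

theorem ncard_setOf_ncard_lt (t r : ℕ) :
    {X : Set (Fin t) | X.ncard < r}.ncard = ∑ i ∈ Finset.range r, t.choose i := by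
  classical
  have h : {X : Set (Fin t) | X.ncard < r} = (fun S : Finset (Fin t) => (S : Set (Fin t))) ''
      (((Finset.range r).biUnion fun i => Finset.powersetCard i Finset.univ :
        Finset (Finset (Fin t))) : Set (Finset (Fin t))) := by
    ext X
    simp only [Set.mem_ofPred_eq, Set.mem_image, SetLike.mem_coe, Finset.mem_biUnion,
      Finset.mem_range, Finset.mem_powersetCard, Finset.subset_univ, true_and]
    constructor
    · intro hX
      exact ⟨X.toFinset, ⟨_, hX, (Set.ncard_eq_toFinset_card' X).symm⟩, by simp⟩
    · rintro ⟨S, ⟨i, hi, hS⟩, rfl⟩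
      rwa [Set.ncard_coe_finset, hS]
  rw [h, Set.ncard_image_of_injective _ Finset.coe_injective, Set.ncard_coe_finset,
    Finset.card_biUnion]
  · simp
  · intro i _ j _ hij
    exact Finset.pairwise_disjoint_powersetCard _ hij

namespace SimpleGraph

variable {V W : Type*}

theorem Free.comap_embedding {U : Type*} {H : SimpleGraph U} {G : SimpleGraph W} (h : H.Free G)
    (f : V ↪ W) : H.Free (G.comap f) :=
  fun hc => h (hc.trans ⟨(Embedding.comap f G).toCopy⟩)

/-- The number of labelled graphs on `s` vertices that do not contain `H`. -/
noncomputable def freeCount (H : SimpleGraph V) (s : ℕ) : ℕ :=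
  {G : SimpleGraph (Fin s) | H.Free G}.ncard

theorem completeBipartiteGraph_isContained {k l : ℕ} {G : SimpleGraph W} (f : Fin k ↪ W)
    (g : Fin l ↪ W) (h : ∀ i j, G.Adj (f i) (g j)) :
    completeBipartiteGraph (Fin k) (Fin l) ⊑ G := by
  refine ⟨⟨⟨Sum.elim f g, ?_⟩, ?_⟩⟩
  · rintro (i | i) (j | j) hij
    · simp at hij
    · exact h i j
    · exact (h j i).symm
    · simp at hij
  · exact f.injective.sumElim g.injective fun i j => (h i j).ne

theorem tripartite_isContained {G : SimpleGraph W} (f g k : Fin 3 ↪ W)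
    (hfg : ∀ i j, G.Adj (f i) (g j)) (hfk : ∀ i j, G.Adj (f i) (k j))
    (hgk : ∀ i j, G.Adj (g i) (k j)) : tripartite ⊑ G := by
  let p : Fin 3 → Fin 3 ↪ W := ![f, g, k]
  have hp : ∀ i j, i ≠ j → ∀ a b, G.Adj (p i a) (p j b) := by
    intro i j hij a b
    fin_cases i <;> fin_cases j <;>
      first
        | exact absurd rfl hij
        | exact hfg _ _ | exact hfk _ _ | exact hgk _ _
        | exact (hfg _ _).symm | exact (hfk _ _).symm | exact (hgk _ _).symm
  refine ⟨⟨⟨fun x => p x.1 x.2, fun {x y} hxy => hp _ _ (by simpa using hxy) _ _⟩, ?_⟩⟩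
  rintro ⟨i, a⟩ ⟨j, b⟩ hab
  obtain rfl : i = j := by
    by_contra hij
    exact (hp i j hij a b).ne hab
  obtain rfl : a = b := (p i).injective hab
  rfl

/-- In a graph without `K_{16,16}`, at most `15` vertices share a given set of `16` neighbours, so
almost every vertex has fewer than `16` neighbours in any fixed set of `64` vertices. There are
fewer than `2 ^ 48` such neighbourhoods. -/
theorem exists_freeCount_completeBipartiteGraph_le : ∃ C : ℕ, ∀ m : ℕ,
    freeCount (completeBipartiteGraph (Fin 16) (Fin 16)) (64 + m) ≤
      C * (2 ^ 48) ^ m * freeCount (completeBipartiteGraph (Fin 16) (Fin 16)) m := by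
  obtain ⟨C, hC⟩ := exists_card_le_mul_pow (Fin 64) 15
  refine ⟨C, fun m => ?_⟩
  have h := hC (Fin m) (Fin (64 + m)) finSumFinEquiv {X | X.ncard < 16}ᶜ (2 ^ 48)
    {G | (completeBipartiteGraph (Fin 16) (Fin 16)).Free G}
    {G | (completeBipartiteGraph (Fin 16) (Fin 16)).Free G} ?_ ?_ ?_
  · rwa [Nat.card_eq_fintype_card, Fintype.card_fin] at h
  · rw [compl_compl, ncard_setOf_ncard_lt]
    decide +kernel
  · intro G hG
    exact Free.comap_embedding hG
      ⟨fun w => finSumFinEquiv (Sum.inr w), finSumFinEquiv.injective.comp Sum.inr_injective⟩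
  · intro G hG X hX
    by_contra! hcon
    obtain ⟨f, hf⟩ := exists_embedding_of_le_ncard (k := 16) (by norm_num)
      (not_lt.1 hX : 16 ≤ X.ncard)
    obtain ⟨g, hg⟩ := exists_embedding_of_le_ncard (k := 16) (by norm_num) hcon
    refine hG (completeBipartiteGraph_isContained
      (f.trans ⟨fun a => finSumFinEquiv (Sum.inl a),
        finSumFinEquiv.injective.comp Sum.inl_injective⟩)
      (g.trans ⟨fun w => finSumFinEquiv (Sum.inr w),
        finSumFinEquiv.injective.comp Sum.inr_injective⟩) fun i j => ?_)
    have hgj : crossNeighbors (G.comap finSumFinEquiv) (g j) = X := hg j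
    have := hf i
    rw [← hgj] at this
    exact this

/-- The neighbourhoods with at most two vertices in one of the two sides of a `K_{16,16}`. -/
theorem ncard_compl_setOf_three_le_le :
    {X : Set (Fin 16 ⊕ Fin 16) |
      3 ≤ (Sum.inl ⁻¹' X).ncard ∧ 3 ≤ (Sum.inr ⁻¹' X).ncard}ᶜ.ncard + 1 ≤ 2 ^ 25 := by
  let A : Set (Set (Fin 16)) := {X | X.ncard < 3}
  have hA : A.ncard = 137 := by
    rw [ncard_setOf_ncard_lt]
    decide +kernel
  have hcard : Nat.card (Set (Fin 16)) = 65536 := by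
    simp [Nat.card_eq_fintype_card]
  have h : {X : Set (Fin 16 ⊕ Fin 16) |
      3 ≤ (Sum.inl ⁻¹' X).ncard ∧ 3 ≤ (Sum.inr ⁻¹' X).ncard}ᶜ
      = Set.sumEquiv ⁻¹' (A ×ˢ Set.univ ∪ Set.univ ×ˢ A) := by
    ext X
    simp only [Set.mem_compl_iff, Set.mem_ofPred_eq, Set.mem_preimage, Set.mem_union, Set.mem_prod,
      Set.mem_univ, and_true, true_and, A, not_and_or, not_le]
    rfl
  rw [h, Set.ncard_preimage_of_injective_subset_range (OrderIso.injective _)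
    (by simp [(OrderIso.surjective _).range_eq])]
  have := Set.ncard_union_le (A ×ˢ Set.univ) (Set.univ ×ˢ A)
  rw [Set.ncard_prod, Set.ncard_prod, Set.ncard_univ, hA, hcard] at this
  omega

/-- A graph without `K_{3,3,3}` is without `K_{16,16}`, or else all but boundedly many vertices have
at most two neighbours in one of the two sides of a copy of `K_{16,16}`. -/
theorem exists_freeCount_tripartite_le : ∃ C : ℕ, ∀ m : ℕ,
    freeCount tripartite (32 + m) ≤
      freeCount (completeBipartiteGraph (Fin 16) (Fin 16)) (32 + m) +
        (32 + m) ^ 32 * (C * (2 ^ 25) ^ m * freeCount tripartite m) := by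
  obtain ⟨C, hC⟩ := exists_card_le_mul_pow (Fin 16 ⊕ Fin 16) 2
  refine ⟨C, fun m => ?_⟩
  let Q : (Fin 16 ⊕ Fin 16 ↪ Fin (32 + m)) → Set (SimpleGraph (Fin (32 + m))) := fun φ =>
    {G | tripartite.Free G ∧ ∀ i j, G.Adj (φ (Sum.inl i)) (φ (Sum.inr j))}
  have hcover : {G : SimpleGraph (Fin (32 + m)) | tripartite.Free G} ⊆
      {G | (completeBipartiteGraph (Fin 16) (Fin 16)).Free G} ∪ ⋃ φ, Q φ := by
    intro G hG
    by_cases h : completeBipartiteGraph (Fin 16) (Fin 16) ⊑ G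
    · obtain ⟨c⟩ := h
      exact Or.inr (Set.mem_iUnion.2
        ⟨c.toEmbedding, hG, fun i j => c.toHom.map_adj (by simp)⟩)
    · exact Or.inl h
  have hQ : ∀ φ, (Q φ).ncard ≤ C * (2 ^ 25) ^ m * freeCount tripartite m := by
    intro φ
    obtain ⟨e', he'⟩ := exists_equiv_extending φ
    have hm : Nat.card ((Set.range φ)ᶜ : Set (Fin (32 + m))) = m := by
      have := Nat.card_congr e'
      rw [Nat.card_sum, Nat.card_sum] at this
      simp only [Nat.card_eq_fintype_card (α := Fin _), Fintype.card_fin] at this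
      omega
    let e : (Fin 16 ⊕ Fin 16) ⊕ Fin m ≃ Fin (32 + m) :=
      (Equiv.sumCongr (Equiv.refl _) (Finite.equivFinOfCardEq hm).symm).trans e'
    have he : ∀ a, e (Sum.inl a) = φ a := he'
    have h := hC (Fin m) (Fin (32 + m)) e
      {X | 3 ≤ (Sum.inl ⁻¹' X).ncard ∧ 3 ≤ (Sum.inr ⁻¹' X).ncard} (2 ^ 25)
      (Q φ) {G | tripartite.Free G} ncard_compl_setOf_three_le_le ?_ ?_
    · rwa [Nat.card_eq_fintype_card, Fintype.card_fin] at h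
    · intro G hG
      exact Free.comap_embedding hG.1
        ⟨fun w => e (Sum.inr w), e.injective.comp Sum.inr_injective⟩
    · intro G hG X hX
      by_contra! hcon
      obtain ⟨f, hf⟩ := exists_embedding_of_le_ncard (by norm_num) hX.1
      obtain ⟨g, hg⟩ := exists_embedding_of_le_ncard (by norm_num) hX.2
      obtain ⟨k, hk⟩ := exists_embedding_of_le_ncard (k := 3) (by norm_num) hcon
      have hkX : ∀ j, ∀ a ∈ X, G.Adj (φ a) (e (Sum.inr (k j))) := by
        intro j a ha
        have hkj : crossNeighbors (G.comap e) (k j) = X := hk j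
        rw [← hkj] at ha
        rw [← he]
        exact ha
      exact hG.1 (tripartite_isContained
        ((f.trans ⟨Sum.inl, Sum.inl_injective⟩).trans φ)
        ((g.trans ⟨Sum.inr, Sum.inr_injective⟩).trans φ)
        (k.trans ⟨fun w => e (Sum.inr w), e.injective.comp Sum.inr_injective⟩)
        (fun i j => hG.2 _ _) (fun i j => hkX j _ (hf i)) (fun i j => hkX j _ (hg i)))
  have hemb : Fintype.card (Fin 16 ⊕ Fin 16 ↪ Fin (32 + m)) ≤ (32 + m) ^ 32 := by
    rw [Fintype.card_embedding_eq]
    simpa using Nat.descFactorial_le_pow (32 + m) 32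
  calc freeCount tripartite (32 + m) ≤ _ := Set.ncard_le_ncard hcover
    _ ≤ _ + (⋃ φ, Q φ).ncard := Set.ncard_union_le _ _
    _ ≤ _ + ∑ φ, (Q φ).ncard := by
        gcongr
        exact Set.ncard_iUnion_le_of_fintype _
    _ ≤ _ := by
        refine Nat.add_le_add_left ?_ _
        refine (Finset.sum_le_card_nsmul _ _ _ fun φ _ => hQ φ).trans ?_
        rw [smul_eq_mul, Finset.card_univ]
        gcongr

end SimpleGraph

/-! ### Solving the recursions -/

theorem exists_forall_le_of_le_add_half {u : ℕ → ℝ} {p : ℕ} (hp : 0 < p) {H : ℝ}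
    (h : ∀ᶠ m in atTop, u (p + m) ≤ H + u m / 2) : ∃ K, ∀ s, u s ≤ K := by
  obtain ⟨m₀, hm₀⟩ := eventually_atTop.1 h
  have hsum : 0 ≤ ∑ i ∈ Finset.range (p + m₀), |u i| := Finset.sum_nonneg fun _ _ => abs_nonneg _
  refine ⟨2 * |H| + ∑ i ∈ Finset.range (p + m₀), |u i|, fun s => ?_⟩
  induction s using Nat.strong_induction_on with
  | _ s ih =>
    rcases lt_or_ge s (p + m₀) with hs | hs
    · have := Finset.single_le_sum (f := fun i => |u i|) (fun i _ => abs_nonneg _)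
        (Finset.mem_range.2 hs)
      linarith [le_abs_self (u s), abs_nonneg H]
    · obtain ⟨m, rfl⟩ := Nat.exists_eq_add_of_le (show p ≤ s by omega)
      linarith [hm₀ m (by omega), ih m (by omega), le_abs_self H]

/-- If passing from `m` to `p + m` vertices costs a factor `2 ^ (j m)` up to polynomial terms, where
`j < 2 θ p`, the growth is at most of order `2 ^ (θ s ^ 2)`. -/
theorem exists_le_mul_two_rpow_sq {a b : ℕ → ℝ} {p r j : ℕ} {c θ Kb : ℝ} (hp : 0 < p)
    (ha : ∀ s, 0 ≤ a s) (hj : (j : ℝ) < 2 * θ * p)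
    (hb : ∀ s : ℕ, b s ≤ Kb * 2 ^ (θ * (s : ℝ) ^ 2))
    (hrec : ∀ m : ℕ, a (p + m) ≤ b (p + m) + (↑(p + m) : ℝ) ^ r * (c * (2 ^ j) ^ m * a m)) :
    ∃ K, ∀ s : ℕ, a s ≤ K * 2 ^ (θ * (s : ℝ) ^ 2) := by
  set δ : ℝ := 2 * θ * p - j with hδ
  have hδ0 : 0 < δ := by rw [hδ]; linarith
  set q : ℝ := 2 ^ (-δ) with hq
  have hq0 : 0 < q := by positivity
  have hq1 : q < 1 := Real.rpow_lt_one_of_one_lt_of_neg (by norm_num) (by linarith)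
  set c' : ℝ := c * 2 ^ (δ * p - θ * (p : ℝ) ^ 2) with hc'
  have hlim : Tendsto (fun m : ℕ => c' * ((↑(p + m) : ℝ) ^ r * q ^ (p + m))) atTop (𝓝 (c' * 0)) := by
    refine Tendsto.const_mul _ ?_
    have := tendsto_pow_const_mul_const_pow_of_abs_lt_one r
      (show |q| < 1 by rwa [abs_of_pos hq0])
    have h2 := (tendsto_add_atTop_iff_nat p).2 this
    simpa [add_comm] using h2
  rw [mul_zero] at hlim
  have hev : ∀ᶠ m : ℕ in atTop, c' * ((↑(p + m) : ℝ) ^ r * q ^ (p + m)) ≤ 1 / 2 :=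
    (hlim.eventually_lt_const (by norm_num)).mono fun _ h => h.le
  have hpos : ∀ s : ℕ, (0 : ℝ) < 2 ^ (θ * (s : ℝ) ^ 2) := fun s => by positivity
  -- The normalised sequence satisfies `u (p + m) ≤ Kb + u m / 2` for large `m`.
  obtain ⟨K, hK⟩ := exists_forall_le_of_le_add_half (u := fun s : ℕ => a s / 2 ^ (θ * (s : ℝ) ^ 2))
    (H := Kb) hp (by
      filter_upwards [hev] with m hm
      rw [div_le_iff₀ (hpos _)]
      have hsplit : c * (2 ^ j) ^ m * (2 : ℝ) ^ (θ * (m : ℝ) ^ 2)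
          = c' * q ^ (p + m) * 2 ^ (θ * (↑(p + m) : ℝ) ^ 2) := by
        rw [hc', hq, ← pow_mul, ← Real.rpow_natCast 2 (j * m), ← Real.rpow_mul_natCast (by norm_num),
          mul_assoc, mul_assoc, mul_assoc,
          ← Real.rpow_add (by norm_num), ← Real.rpow_add (by norm_num),
          ← Real.rpow_add (by norm_num)]
        congr 2
        push_cast
        rw [hδ]
        ring
      have hmul : (↑(p + m) : ℝ) ^ r * (c * (2 ^ j) ^ m * a m)
          = c' * ((↑(p + m) : ℝ) ^ r * q ^ (p + m)) * (a m / 2 ^ (θ * (m : ℝ) ^ 2))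
            * 2 ^ (θ * (↑(p + m) : ℝ) ^ 2) := by
        rw [← mul_div_assoc, div_mul_eq_mul_div, eq_div_iff (hpos m).ne']
        linear_combination (a m * (↑(p + m) : ℝ) ^ r) * hsplit
      have hu : 0 ≤ a m / 2 ^ (θ * (m : ℝ) ^ 2) := div_nonneg (ha m) (hpos m).le
      calc a (p + m) ≤ b (p + m) + _ := hrec m
        _ ≤ Kb * 2 ^ (θ * (↑(p + m) : ℝ) ^ 2) +
            1 / 2 * (a m / 2 ^ (θ * (m : ℝ) ^ 2)) * 2 ^ (θ * (↑(p + m) : ℝ) ^ 2) := by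
              rw [hmul]
              refine add_le_add (hb _) ?_
              gcongr
        _ = _ := by ring)
  exact ⟨K, fun s => (div_le_iff₀ (hpos s)).1 (hK s)⟩

namespace SimpleGraph

/-- The true exponent is `s ^ 2 / 4 + o(s ^ 2)`. Here `13 / 32` is chosen for room above the values
`48 / 128` and `25 / 64` that the two recursions give. -/
theorem exists_freeCount_tripartite_le_two_rpow :
    ∃ K : ℝ, ∀ s : ℕ, (freeCount tripartite s : ℝ) ≤ K * 2 ^ (13 / 32 * (s : ℝ) ^ 2) := by
  obtain ⟨C₁, h₁⟩ := exists_freeCount_completeBipartiteGraph_le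
  obtain ⟨C₂, h₂⟩ := exists_freeCount_tripartite_le
  obtain ⟨K₁, hK₁⟩ := exists_le_mul_two_rpow_sq (b := fun _ => 0) (p := 64) (r := 0) (j := 48)
    (c := C₁) (θ := 13 / 32) (Kb := 0)
    (a := fun s => (freeCount (completeBipartiteGraph (Fin 16) (Fin 16)) s : ℝ)) (by norm_num)
    (fun s => Nat.cast_nonneg _) (by norm_num) (fun s => by simp)
    (fun m => by rw [pow_zero, one_mul, zero_add]; exact_mod_cast h₁ m)
  exact exists_le_mul_two_rpow_sq (p := 32) (r := 32) (j := 25) (c := C₂) (by norm_num)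
    (fun s => Nat.cast_nonneg _) (by norm_num) hK₁ (fun m => by exact_mod_cast h₂ m)

end SimpleGraph

/-! ### The first moment bound -/

open SimpleGraph in
/-- Every graph on `n = R_D(s, s, d)` vertices has an `s`-set on which the graph or its complement
has no `K_{3,3,3}`; counting these graphs by the union bound over the `s`-sets gives the claim. -/
theorem two_pow_choose_le {d : ℕ} (hd1 : 1 ≤ d) (hd5 : d ≤ 5) (s : ℕ) :
    2 ^ s.choose 2 ≤ 2 * distanceRamsey s s d ^ s * freeCount tripartite s := by
  set n := distanceRamsey s s d with hn
  let F : Set (SimpleGraph (Fin s)) := {H | tripartite.Free H}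
  let A : (Fin s ↪ Fin n) → Set (SimpleGraph (Fin n)) := fun φ => {G | G.comap φ ∈ F}
  have hcontains : ∀ G : SimpleGraph (Fin n), ContainsInducedDistanceGraph s d G →
      ∃ φ, G ∈ A φ := by
    rintro G ⟨S, hS, hiso⟩
    refine ⟨(S.orderEmbOfFin hS).toEmbedding, ?_⟩
    have hfree := hiso.tripartite_free hd5
    exact hfree.comap_embedding (V := Fin s) (W := (S : Set (Fin n)))
      ⟨fun i => ⟨S.orderEmbOfFin hS i, S.orderEmbOfFin_mem hS i⟩,
        fun i j hij => (S.orderEmbOfFin hS).injective (Subtype.ext_iff.1 hij)⟩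
  have hcover : (Set.univ : Set (SimpleGraph (Fin n))) ⊆
      (⋃ φ, A φ) ∪ compl ⁻¹' (⋃ φ, A φ) := by
    intro G _
    rcases distanceRamsey_spec hd1 s s G with h | h
    · exact Or.inl (Set.mem_iUnion.2 (hcontains G h))
    · exact Or.inr (Set.mem_iUnion.2 (hcontains Gᶜ h))
  set N := Nat.card (SimpleGraph (Fin n)) with hN
  have hN0 : 0 < N := Nat.card_pos
  have hA : ∀ φ, (A φ).ncard * 2 ^ s.choose 2 = freeCount tripartite s * N := by
    intro φ
    rw [← card_eq_two_pow]
    exact card_comap_mem_mul φ F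
  have hemb : Fintype.card (Fin s ↪ Fin n) ≤ n ^ s := by
    rw [Fintype.card_embedding_eq]
    simpa using Nat.descFactorial_le_pow n s
  have hunion : (⋃ φ, A φ).ncard * 2 ^ s.choose 2 ≤ n ^ s * (freeCount tripartite s * N) := by
    calc _ ≤ (∑ φ, (A φ).ncard) * 2 ^ s.choose 2 := by
          gcongr
          exact Set.ncard_iUnion_le_of_fintype _
      _ = Fintype.card (Fin s ↪ Fin n) * (freeCount tripartite s * N) := by
          rw [Finset.sum_mul, Finset.sum_congr rfl fun φ _ => hA φ]
          simp
      _ ≤ _ := by gcongr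
  have htotal : N ≤ 2 * (⋃ φ, A φ).ncard := by
    have h := (Set.ncard_le_ncard hcover).trans (Set.ncard_union_le _ _)
    rw [Set.ncard_univ, Set.ncard_preimage_of_injective_subset_range compl_injective
      (by simp [compl_surjective.range_eq])] at h
    omega
  refine Nat.le_of_mul_le_mul_right (c := N) ?_ hN0
  calc 2 ^ s.choose 2 * N ≤ 2 ^ s.choose 2 * (2 * (⋃ φ, A φ).ncard) := by gcongr
    _ = 2 * ((⋃ φ, A φ).ncard * 2 ^ s.choose 2) := by ring
    _ ≤ 2 * (n ^ s * (freeCount tripartite s * N)) := by gcongr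
    _ = _ := by ring

theorem eventually_rpow_le_distanceRamsey {d : ℕ} (hd1 : 1 ≤ d) (hd5 : d ≤ 5) :
    ∀ᶠ s : ℕ in atTop, ((64 : ℝ) / 41) ^ ((s : ℝ) / 12) ≤ (distanceRamsey s s d : ℝ) := by
  obtain ⟨K, hK⟩ := SimpleGraph.exists_freeCount_tripartite_le_two_rpow
  -- This is `(64 / 41) ^ 3 ≤ 4`.
  have hbase : ((64 : ℝ) / 41) ^ (1 / 12 : ℝ) ≤ 2 ^ (1 / 18 : ℝ) := by
    rw [← Real.rpow_le_rpow_iff (z := 36) (by positivity) (by positivity) (by norm_num),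
      ← Real.rpow_mul (by norm_num), ← Real.rpow_mul (by norm_num)]
    norm_num
  obtain ⟨L, hL⟩ : ∃ L : ℕ, 2 * K < 2 ^ L := pow_unbounded_of_one_lt _ (by norm_num)
  filter_upwards [eventually_ge_atTop (L + 100)] with s hs
  set n := distanceRamsey s s d
  have hs0 : (L : ℝ) + 100 ≤ s := by exact_mod_cast hs
  have hL0 : (0 : ℝ) ≤ L := Nat.cast_nonneg L
  have hcount : (2 : ℝ) ^ s.choose 2 ≤ 2 * (n : ℝ) ^ s * SimpleGraph.freeCount tripartite s := by
    exact_mod_cast two_pow_choose_le hd1 hd5 s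
  have hchoose : (2 : ℝ) ^ s.choose 2 = 2 ^ ((s : ℝ) * (s - 1) / 2) := by
    rw [← Real.rpow_natCast, Nat.cast_choose_two]
  have hbound : (2 : ℝ) ^ ((s : ℝ) * (s - 1) / 2) ≤
      (n : ℝ) ^ s * (2 ^ ((L : ℝ) + 13 / 32 * (s : ℝ) ^ 2)) := by
    rw [← hchoose, Real.rpow_add (by norm_num), Real.rpow_natCast]
    calc (2 : ℝ) ^ s.choose 2 ≤ 2 * (n : ℝ) ^ s * (K * 2 ^ (13 / 32 * (s : ℝ) ^ 2)) :=
          hcount.trans (by gcongr; exact hK s)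
      _ = (n : ℝ) ^ s * (2 * K * 2 ^ (13 / 32 * (s : ℝ) ^ 2)) := by ring
      _ ≤ _ := by gcongr
  have hpow : ((2 : ℝ) ^ (1 / 18 * (s : ℝ))) ^ s ≤ (n : ℝ) ^ s := by
    rw [← Real.rpow_natCast, ← Real.rpow_mul (by norm_num)]
    have hpos : (0 : ℝ) < 2 ^ ((L : ℝ) + 13 / 32 * (s : ℝ) ^ 2) := by positivity
    refine le_of_mul_le_mul_right (le_trans ?_ hbound) hpos
    rw [← Real.rpow_add (by norm_num)]
    refine Real.rpow_le_rpow_of_exponent_le (by norm_num) ?_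
    nlinarith
  calc ((64 : ℝ) / 41) ^ ((s : ℝ) / 12) = (((64 : ℝ) / 41) ^ (1 / 12 : ℝ)) ^ (s : ℝ) := by
        rw [← Real.rpow_mul (by norm_num)]; ring_nf
    _ ≤ (2 ^ (1 / 18 : ℝ)) ^ (s : ℝ) := by gcongr
    _ = 2 ^ (1 / 18 * (s : ℝ)) := by rw [← Real.rpow_mul (by norm_num)]
    _ ≤ n := le_of_pow_le_pow_left₀ (by omega) (Nat.cast_nonneg n) hpow

/-! ### The numerical value of the exponent -/

set_option exponentiation.threshold 1000 in
/-- The rational bounds `221 / 344` and `451 / 702` for `log₂ (64 / 41)` are integer inequalities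
between powers. -/
theorem abs_logb_sub_lt : |Real.logb 2 ((64 : ℝ) / 41) / 12 - 0.053537| < 0.000001 := by
  have h1 : (221 : ℝ) < 344 * Real.logb 2 (64 / 41) := by
    have h := Real.logb_lt_logb (b := 2) (x := 2 ^ 221) (y := (64 / 41 : ℝ) ^ 344) (by norm_num)
      (by norm_num) (by rw [div_pow, lt_div_iff₀ (by positivity)]; norm_num)
    rw [Real.logb_pow, Real.logb_pow, Real.logb_self_eq_one (by norm_num)] at h
    simpa using h
  have h2 : 702 * Real.logb 2 (64 / 41) < (451 : ℝ) := by
    have h := Real.logb_lt_logb (b := 2) (x := (64 / 41 : ℝ) ^ 702) (y := 2 ^ 451) (by norm_num)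
      (by positivity) (by rw [div_pow, div_lt_iff₀ (by positivity)]; norm_num)
    rw [Real.logb_pow, Real.logb_pow, Real.logb_self_eq_one (by norm_num)] at h
    simpa using h
  rw [abs_lt]
  constructor <;> norm_num at * <;> linarith

/-! ### The lower bound for the distance Ramsey number -/

theorem mainTheorem6 (d : ℕ) (hd : d = 4 ∨ d = 5) :
    (∃ f : ℕ → ℝ, Tendsto f atTop (𝓝 0) ∧
      ∀ s : ℕ, 1 ≤ s →
        ((64 : ℝ) / 41) ^ ((s : ℝ) / 12 * (1 + f s)) ≤ (distanceRamsey s s d : ℝ)) ∧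
    |Real.logb 2 ((64 : ℝ) / 41) / 12 - 0.053537| < 0.000001 := by
  have hd1 : 1 ≤ d := by omega
  have hd5 : d ≤ 5 := by omega
  refine ⟨?_, abs_logb_sub_lt⟩
  obtain ⟨s₀, hs₀⟩ := eventually_atTop.1 (eventually_rpow_le_distanceRamsey hd1 hd5)
  -- For large `s` no correction is needed, and `f s = -1` makes the bound trivial for small `s`.
  refine ⟨fun s => if s₀ ≤ s then 0 else -1, ?_, fun s hs => ?_⟩
  · refine tendsto_const_nhds.congr' ?_
    filter_upwards [eventually_ge_atTop s₀] with s hs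
    rw [if_pos hs]
  · dsimp only
    split_ifs with h
    · simpa using hs₀ s h
    · simpa using distanceRamsey_pos hd1 hs
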